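/- Let $\mathcal X$ be a finite or countably infinite set, $A\subset\mathcal X$ a set of interesting items, and $P_1,\dots,P_K$ ($K\ge 1$) probability distributions on $\mathcal X$ (the experts) such that $A\cap\mathrm{supp}(P_i)\cap\mathrm{supp}(P_j)=\emptyset$ for $i\neq j$. Let $(X_{i,n})_{1\le i\le K,\,n\ge1}$ be independent random variables, $X_{i,n}$ with law $P_i$; the $n$-th request to expert $i$ returns $X_{i,n}$. For a sequence of requests $(I_t)_{t\ge1}$ in $\{1,\dots,K\}$ let $n_{i,t}=\#\{s\le t: I_s=i\}$, let $D_t=\{X_{i,m}:1\le i\le K,\ 1\le m\le n_{i,t}\}$ be the set of items seen after $t$ requests, and for $\lambda\in\mathbb R$ let $$T_I(\lambda)=\inf\{t\ge1:\ P_i(A\setminus D_t)\le\lambda\ \text{ for all } i\}\in\mathbb N\cup\{\infty\}$$ be its waiting time. Let $T^*(\lambda)=\min_I T_I(\lambda)$, the minimum over all sequences of requests, be the waiting time of the omniscient oracle, which knows $\lambda$ and all the answers $X_{i,n}$. Good-UCB with constant $C$ chooses $I_t=t$ for $1\le t\le K$ and, for $t\ge K+1$, chooses $I_t$ (ties broken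 arbitrarily) maximizing over $i$ the index $$\hat R_{i,t-1}+C\sqrt{\frac{\log(4t)}{n_{i,t-1}}},$$ where $\hat R_{i,t}$ is $1/n_{i,t}$ times the number of $x\in A$ that occur exactly once among $X_{i,1},\dots,X_{i,n_{i,t}}$ and exactly once among the answers of all the experts to the first $t$ requests. Let $T_{UCB}(\lambda)$ be the waiting time of Good-UCB. Let $c>0$ and $S\ge1$ be real numbers and run Good-UCB with $C=(1+\sqrt2)\sqrt{c+2}$. Then there is an event of probability at least $1-\dfrac{K}{cS^c}$ on which, simultaneously for all $\lambda\in(0,1)$, $$T_{UCB}(\lambda)\le T^*+KS\log\bigl(8T^*+16KS\log(KS)\bigr),\qquad T^*=T^*\Bigl(\lambda-\frac3S-2(1+\sqrt2)\sqrt{\frac{c+2}{S}}\Bigr),$$ where the right-hand side is $\infty$ if $T^*=\infty$; in particular $T_{UCB}(\lambda)<\infty$ whenever $T^*<\infty$. -/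

import Mathlib

open MeasureTheory ProbabilityTheory

namespace Discovery

/-- The support of a measure on a countable discrete space: the points of positive mass. -/
def supp {𝒳 : Type*} [MeasurableSpace 𝒳] (Q : Measure 𝒳) : Set 𝒳 := {x | Q {x} ≠ 0}

/-- `pulls I t i` is the number of requests made to expert `i` among the first `t` requests, when
the successive requests go to the experts `I 0, I 1, I 2, …` (so `I t` is the expert of
request number `t + 1`). -/
def pulls {K : ℕ} (I : ℕ → Fin K) (t : ℕ) (i : Fin K) : ℕ :=
  ((Finset.range t).filter (fun s => I s = i)).card

/-- The items seen during the first `t` requests. Here `x i m` is the answer of expert `i` to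
the `(m + 1)`-st request made to it. -/
def seen {𝒳 : Type*} {K : ℕ} (x : Fin K → ℕ → 𝒳) (I : ℕ → Fin K) (t : ℕ) : Set 𝒳 :=
  {y | ∃ i, ∃ m, m < pulls I t i ∧ x i m = y}

/-- The number of occurrences of the item `y` among the first `n` answers of expert `i`. -/
noncomputable def occ {𝒳 : Type*} {K : ℕ} (x : Fin K → ℕ → 𝒳) (i : Fin K) (n : ℕ) (y : 𝒳) : ℕ :=
  {m : ℕ | m < n ∧ x i m = y}.ncard

/-- The Good-Turing estimate, after `t` requests, of the missing mass of expert `i`: the number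
of interesting items that were seen exactly once by expert `i` and exactly once in total by all
the experts, divided by the number of requests made to expert `i`. -/
noncomputable def goodTuring {𝒳 : Type*} {K : ℕ} (A : Set 𝒳) (x : Fin K → ℕ → 𝒳) (I : ℕ → Fin K)
    (t : ℕ) (i : Fin K) : ℝ :=
  ({y ∈ A | occ x i (pulls I t i) y = 1 ∧ ∑ j, occ x j (pulls I t j) y = 1}.ncard : ℝ)
    / (pulls I t i : ℝ)

/-- The index of expert `i` used by Good-UCB with constant `C` for request number `t + 1`. -/
noncomputable def ucbIndex {𝒳 : Type*} {K : ℕ} (C : ℝ) (A : Set 𝒳) (x : Fin K → ℕ → 𝒳)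
    (I : ℕ → Fin K) (t : ℕ) (i : Fin K) : ℝ :=
  goodTuring A x I t i + C * Real.sqrt (Real.log (4 * ((t : ℝ) + 1)) / (pulls I t i : ℝ))

/-- `I` is a sequence of requests made by Good-UCB with constant `C`, when the answers are `x`:
first one request to each expert, in order, and then always a request to an expert of maximal
index (ties may be broken in any way). -/
def IsGoodUCB {𝒳 : Type*} {K : ℕ} (C : ℝ) (A : Set 𝒳) (x : Fin K → ℕ → 𝒳)
    (I : ℕ → Fin K) : Prop :=
  (∀ t, t < K → (I t : ℕ) = t) ∧
    ∀ t, K ≤ t → ∀ i, ucbIndex C A x I t i ≤ ucbIndex C A x I t (I t)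

/-- The waiting time of the sequence of requests `I`: the first time `t ≥ 1` at which, for every
expert, the mass of the interesting items that were not seen yet is at most `l`
(`⊤` if there is no such time). -/
noncomputable def waitingTime {𝒳 : Type*} [MeasurableSpace 𝒳] {K : ℕ} (P : Fin K → Measure 𝒳)
    (A : Set 𝒳) (x : Fin K → ℕ → 𝒳) (I : ℕ → Fin K) (l : ℝ) : ℕ∞ :=
  sInf ((fun t : ℕ => (t : ℕ∞)) '' {t : ℕ | 1 ≤ t ∧ ∀ i, (P i).real (A \ seen x I t) ≤ l})

/-- The waiting time of the omniscient oracle, which knows `l` and all the answers `x`: the least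
waiting time over all sequences of requests. -/
noncomputable def oracleTime {𝒳 : Type*} [MeasurableSpace 𝒳] {K : ℕ} (P : Fin K → Measure 𝒳)
    (A : Set 𝒳) (x : Fin K → ℕ → 𝒳) (l : ℝ) : ℕ∞ :=
  ⨅ I : ℕ → Fin K, waitingTime P A x I l

end Discovery

/-! The proof has a probabilistic half and a deterministic half.

Concentration. The Good-Turing estimate minus the missing mass is a sum over items of functions of
their multinomial counts. These counts are dependent, but the expectation of a product of functions
of the counts is `n!` times the `n`-th coefficient of a product of exponential generating series
(`integral_prod_count_eq_coeff`). The coefficients are nonnegative, so the `n`-th one is at most the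
value at `n` divided by `n ^ n`, and that value factors as for independent Poisson counts. There
each item has a centred contribution, and `poisson_factor_le` bounds its exponential moment. The
price is `n! e ^ n / n ^ n ≤ e n`. A Chernoff bound and a union over sample sizes and experts give
the event (`exists_concentration_event`).

Optimism. Supports are disjoint on `A`, so the missing mass of an expert depends only on its own
request count. Consider the last request to expert `i` before Good-UCB succeeds. Some expert still
misses more than `l`, so the maximal index exceeds `l`. If `i` already had at least about `S log
(4T)` requests, its bonus is small, so its own missing mass exceeds the lowered threshold and the
oracle must ask it more often (`early_or_lt_missingMass`). Summing over `i` gives `T ≤ T* + K S log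
(4T)`, which is then solved for `T`. -/

namespace Discovery

/-! ### Occurrence counts and their one-step recursion -/

open scoped Classical in
/-- The number of occurrences of `y` among the first `n` terms of the sequence `w`. -/
noncomputable def count {𝒳 : Type*} (w : ℕ → 𝒳) (n : ℕ) (y : 𝒳) : ℕ :=
  ((Finset.range n).filter (fun m => w m = y)).card

open scoped Classical in
theorem count_succ {𝒳 : Type*} (w : ℕ → 𝒳) (n : ℕ) (y : 𝒳) :
    count w (n + 1) y = count w n y + if w n = y then 1 else 0 := by
  unfold count
  rw [Finset.range_add_one, Finset.filter_insert]
  split_ifs <;> simp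

open scoped Classical in
theorem count_le {𝒳 : Type*} (w : ℕ → 𝒳) (n : ℕ) (y : 𝒳) : count w n y ≤ n :=
  (Finset.card_filter_le _ _).trans (by simp)

theorem occ_eq_count {𝒳 : Type*} {K : ℕ} (x : Fin K → ℕ → 𝒳) (i : Fin K) (n : ℕ) (y : 𝒳) :
    occ x i n y = count (x i) n y := by
  classical
  unfold occ count
  rw [← Set.ncard_coe_finset]
  congr 1
  ext m
  simp

open scoped Classical in
theorem count_eq_sum {𝒳 : Type*} (w : ℕ → 𝒳) (n : ℕ) (y : 𝒳) :
    count w n y = ∑ m : Finset.range n, if w m = y then 1 else 0 := by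
  unfold count
  rw [Finset.card_filter, ← Finset.sum_coe_sort]

theorem count_eq_zero_iff {𝒳 : Type*} (w : ℕ → 𝒳) (n : ℕ) (y : 𝒳) :
    count w n y = 0 ↔ ∀ m < n, w m ≠ y := by
  simp [count, Finset.filter_eq_empty_iff]

open scoped Classical in
-- A new sample either hits one item `y` of `F`, which shifts the argument of that factor alone, or
-- misses `F` and changes nothing.
theorem prod_count_succ {𝒳 : Type*} (w : ℕ → 𝒳) (F : Finset 𝒳) (f : 𝒳 → ℕ → ℝ) (n : ℕ) :
    ∏ x ∈ F, f x (count w (n + 1) x) =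
      ∑ y ∈ F, (if w n = y then 1 else 0) *
          ∏ x ∈ F, Function.update f y (fun k => f y (k + 1)) x (count w n x) +
        (1 - ∑ y ∈ F, if w n = y then 1 else 0) * ∏ x ∈ F, f x (count w n x) := by
  by_cases h : w n ∈ F
  · simp only [ite_mul, one_mul, zero_mul, Finset.sum_ite_eq, h, if_true, sub_self, add_zero]
    refine Finset.prod_congr rfl fun x _ => ?_
    rw [count_succ]
    by_cases hx : w n = x
    · subst hx; simp
    · rw [Function.update_of_ne (Ne.symm hx)]; simp [hx]
  · simp only [ite_mul, one_mul, zero_mul, Finset.sum_ite_eq, h, if_false, sub_zero, zero_add]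
    refine Finset.prod_congr rfl fun x hx => ?_
    rw [count_succ, if_neg (fun h' => h (by rwa [h'])), add_zero]

section Sampling

variable {Ω 𝒳 : Type*} [MeasurableSpace Ω] {μ : Measure Ω}
  [MeasurableSpace 𝒳] [DiscreteMeasurableSpace 𝒳] {Y : ℕ → Ω → 𝒳}

theorem measurable_count (hY : ∀ n, Measurable (Y n)) (n : ℕ) (y : 𝒳) :
    Measurable (fun ω => count (fun m => Y m ω) n y) := by
  classical
  simp_rw [count_eq_sum]
  refine Finset.measurable_sum _ fun m _ => ?_
  exact Measurable.ite (hY m (MeasurableSet.of_discrete (s := {y}))) measurable_const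
    measurable_const

theorem measurable_prod_count (hY : ∀ n, Measurable (Y n)) (F : Finset 𝒳) (f : 𝒳 → ℕ → ℝ) (n : ℕ) :
    Measurable (fun ω => ∏ x ∈ F, f x (count (fun m => Y m ω) n x)) :=
  Finset.measurable_prod _ fun x _ =>
    (measurable_of_countable (f x)).comp (measurable_count hY n x)

theorem integrable_prod_count [IsFiniteMeasure μ] (hY : ∀ n, Measurable (Y n)) (F : Finset 𝒳)
    (f : 𝒳 → ℕ → ℝ) (n : ℕ) :
    Integrable (fun ω => ∏ x ∈ F, f x (count (fun m => Y m ω) n x)) μ := by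
  refine Integrable.of_bound (measurable_prod_count hY F f n).aestronglyMeasurable
    (∏ x ∈ F, ∑ k ∈ Finset.range (n + 1), |f x k|) (Filter.Eventually.of_forall fun ω => ?_)
  rw [Real.norm_eq_abs, Finset.abs_prod]
  refine Finset.prod_le_prod (fun _ _ => abs_nonneg _) fun x _ => ?_
  exact Finset.single_le_sum (f := fun k => |f x k|) (fun _ _ => abs_nonneg _)
    (Finset.mem_range.2 (Nat.lt_succ_of_le (count_le _ _ _)))

variable [Countable 𝒳]

open scoped Classical in
theorem integral_indicator_mul_prod_count [IsProbabilityMeasure μ] {Q : Measure 𝒳}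
    (hY : ∀ n, Measurable (Y n)) (hlaw : ∀ n, μ.map (Y n) = Q) (hind : iIndepFun Y μ)
    (F : Finset 𝒳) (f : 𝒳 → ℕ → ℝ) (n : ℕ) (y : 𝒳) :
    ∫ ω, (if Y n ω = y then 1 else 0) * ∏ x ∈ F, f x (count (fun m => Y m ω) n x) ∂μ =
      Q.real {y} * ∫ ω, ∏ x ∈ F, f x (count (fun m => Y m ω) n x) ∂μ := by
  have h1 := hind.indepFun_finset {n} (Finset.range n) (by simp) hY
  let G : (Finset.range n → 𝒳) → ℝ := fun t => ∏ x ∈ F, f x (∑ m, if t m = x then 1 else 0)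
  let H : (({n} : Finset ℕ) → 𝒳) → ℝ := fun t => if t ⟨n, by simp⟩ = y then 1 else 0
  have h2 := h1.comp (φ := H) (ψ := G) (measurable_of_countable _) (measurable_of_countable _)
  have h3 := h2.integral_mul_eq_mul_integral
    ((measurable_of_countable H).comp (measurable_pi_lambda _ fun m => hY m)).aestronglyMeasurable
    ((measurable_of_countable G).comp (measurable_pi_lambda _ fun m => hY m)).aestronglyMeasurable
  have hG : (G ∘ fun a (i : Finset.range n) => Y i a) =
      fun ω => ∏ x ∈ F, f x (count (fun m => Y m ω) n x) := by
    funext ω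
    simp only [G, Function.comp, count_eq_sum]
  have hH : (H ∘ fun a (i : ({n} : Finset ℕ)) => Y i a) =
      (Y n ⁻¹' {y}).indicator 1 := by
    funext ω
    simp [H, Set.indicator_apply]
  rw [hG, hH, integral_indicator_one (hY n MeasurableSet.of_discrete)] at h3
  rw [← hlaw n, map_measureReal_apply (hY n) MeasurableSet.of_discrete, ← h3]
  refine integral_congr_ae (Filter.Eventually.of_forall fun ω => ?_)
  simp [Set.indicator_apply]

open scoped Classical in
theorem integral_prod_count_succ [IsProbabilityMeasure μ] {Q : Measure 𝒳}
    (hY : ∀ n, Measurable (Y n)) (hlaw : ∀ n, μ.map (Y n) = Q) (hind : iIndepFun Y μ)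
    (F : Finset 𝒳) (f : 𝒳 → ℕ → ℝ) (n : ℕ) :
    ∫ ω, ∏ x ∈ F, f x (count (fun m => Y m ω) (n + 1) x) ∂μ =
      ∑ y ∈ F, Q.real {y} * ∫ ω, ∏ x ∈ F,
          Function.update f y (fun k => f y (k + 1)) x (count (fun m => Y m ω) n x) ∂μ +
        (1 - ∑ y ∈ F, Q.real {y}) * ∫ ω, ∏ x ∈ F, f x (count (fun m => Y m ω) n x) ∂μ := by
  have hint : ∀ (g : 𝒳 → ℕ → ℝ) (y : 𝒳), Integrable (fun ω => (if Y n ω = y then (1 : ℝ) else 0) *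
      ∏ x ∈ F, g x (count (fun m => Y m ω) n x)) μ := by
    intro g y
    refine ((integrable_prod_count hY F g n).indicator
      (hY n (MeasurableSet.of_discrete (s := {y})))).congr (Filter.Eventually.of_forall fun ω => ?_)
    simp [Set.indicator_apply]
  simp_rw [prod_count_succ, sub_mul, one_mul, Finset.sum_mul]
  have h1 := integrable_finsetSum F
    fun y _ => hint (Function.update f y (fun k => f y (k + 1))) y
  have h2 := integrable_finsetSum F fun y _ => hint f y
  have h3 : Integrable (fun ω => ∏ x ∈ F, f x (count (fun m => Y m ω) n x) -
      ∑ y ∈ F, (if Y n ω = y then 1 else 0) * ∏ x ∈ F, f x (count (fun m => Y m ω) n x)) μ :=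
    (integrable_prod_count hY F f n).sub h2
  rw [integral_add h1 h3,
    integral_sub (integrable_prod_count hY F f n) h2,
    integral_finsetSum _ fun y _ => hint _ y, integral_finsetSum _ fun y _ => hint _ y]
  simp_rw [integral_indicator_mul_prod_count hY hlaw hind]

end Sampling

/-! ### Generating series of multinomial expectations -/

/-- The exponential generating series of `g k * a ^ k`. -/
noncomputable def egs (a : ℝ) (g : ℕ → ℝ) : PowerSeries ℝ :=
  PowerSeries.mk fun k => g k * a ^ k / (k.factorial : ℝ)

theorem derivative_egs (a : ℝ) (g : ℕ → ℝ) :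
    PowerSeries.derivative ℝ (egs a g) = PowerSeries.C a * egs a (fun k => g (k + 1)) := by
  ext n
  rw [PowerSeries.coeff_derivative, PowerSeries.coeff_C_mul, egs, egs, PowerSeries.coeff_mk,
    PowerSeries.coeff_mk, Nat.factorial_succ]
  push_cast
  have : (n.factorial : ℝ) ≠ 0 := by positivity
  field_simp
  ring

open scoped Classical in
theorem derivative_prod {ι : Type*} (F : Finset ι) (φ : ι → PowerSeries ℝ) :
    PowerSeries.derivative ℝ (∏ x ∈ F, φ x) =
      ∑ y ∈ F, ∏ x ∈ F, Function.update φ y (PowerSeries.derivative ℝ (φ y)) x := by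
  induction F using Finset.induction_on with
  | empty => simp
  | insert a F ha ih =>
    rw [Finset.prod_insert ha, Derivation.leibniz, ih, Finset.sum_insert ha,
      Finset.prod_insert ha, Function.update_self, smul_eq_mul, smul_eq_mul, Finset.mul_sum,
      add_comm]
    congr 1
    · rw [mul_comm]
      congr 1
      refine Finset.prod_congr rfl fun x hx => ?_
      rw [Function.update_of_ne (fun h => ha (by rwa [← h]))]
    · refine Finset.sum_congr rfl fun y hy => ?_
      rw [Finset.prod_insert ha, Function.update_of_ne (fun h => ha (by rwa [h]))]

/-- The generating series of the expectations of `∏ x ∈ F, f x (count x)` for multinomial samples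
with cell probabilities `p x`, `x ∈ F`, and remaining probability `q`. -/
noncomputable def multinomialSeries {ι : Type*} (q : ℝ) (p : ι → ℝ) (F : Finset ι)
    (f : ι → ℕ → ℝ) : PowerSeries ℝ :=
  egs q (fun _ => 1) * ∏ x ∈ F, egs (p x) (f x)

open scoped Classical in
theorem derivative_multinomialSeries {ι : Type*} (q : ℝ) (p : ι → ℝ) (F : Finset ι)
    (f : ι → ℕ → ℝ) :
    PowerSeries.derivative ℝ (multinomialSeries q p F f) =
      ∑ y ∈ F, PowerSeries.C (p y) *
          multinomialSeries q p F (Function.update f y (fun k => f y (k + 1))) +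
        PowerSeries.C q * multinomialSeries q p F f := by
  unfold multinomialSeries
  rw [Derivation.leibniz, derivative_prod, derivative_egs, smul_eq_mul, smul_eq_mul,
    Finset.mul_sum]
  congr 1
  · refine Finset.sum_congr rfl fun y hy => ?_
    rw [mul_left_comm]
    congr 1
    rw [← Finset.mul_prod_erase F _ hy, ← Finset.mul_prod_erase F _ hy, Function.update_self,
      Function.update_self, derivative_egs, mul_assoc]
    congr 2
    refine Finset.prod_congr rfl fun x hx => ?_
    rw [Function.update_of_ne (Finset.ne_of_mem_erase hx),
      Function.update_of_ne (Finset.ne_of_mem_erase hx)]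
  · ring

theorem coeff_zero_multinomialSeries {ι : Type*} (q : ℝ) (p : ι → ℝ) (F : Finset ι)
    (f : ι → ℕ → ℝ) :
    PowerSeries.coeff 0 (multinomialSeries q p F f) = ∏ x ∈ F, f x 0 := by
  rw [multinomialSeries, PowerSeries.coeff_zero_eq_constantCoeff_apply, map_mul, map_prod]
  simp [egs, ← PowerSeries.coeff_zero_eq_constantCoeff_apply]

/-- Splitting on the outcome of the newest sample gives the expectations the same recursion in `n`
that differentiation gives the coefficients, and the initial values agree. -/
theorem integral_prod_count_eq_coeff {Ω 𝒳 : Type*} [MeasurableSpace Ω] {μ : Measure Ω}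
    [IsProbabilityMeasure μ] [Countable 𝒳] [MeasurableSpace 𝒳] [DiscreteMeasurableSpace 𝒳]
    {Y : ℕ → Ω → 𝒳} {Q : Measure 𝒳}
    (hY : ∀ n, Measurable (Y n)) (hlaw : ∀ n, μ.map (Y n) = Q) (hind : iIndepFun Y μ)
    (F : Finset 𝒳) (f : 𝒳 → ℕ → ℝ) (n : ℕ) :
    ∫ ω, ∏ x ∈ F, f x (count (fun m => Y m ω) n x) ∂μ = (n.factorial : ℝ) *
      PowerSeries.coeff n
        (multinomialSeries (1 - ∑ y ∈ F, Q.real {y}) (fun y => Q.real {y}) F f) := by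
  classical
  induction n generalizing f with
  | zero => rw [coeff_zero_multinomialSeries]; simp [count]
  | succ n ih =>
    rw [integral_prod_count_succ hY hlaw hind]
    simp_rw [ih]
    have h := congrArg (PowerSeries.coeff n) (derivative_multinomialSeries
      (1 - ∑ y ∈ F, Q.real {y}) (fun y => Q.real {y}) F f)
    rw [PowerSeries.coeff_derivative, map_add, map_sum] at h
    simp_rw [PowerSeries.coeff_C_mul] at h
    rw [Nat.factorial_succ]
    push_cast
    rw [mul_comm ((n : ℝ) + 1), mul_assoc, mul_comm ((n : ℝ) + 1), h, mul_add, Finset.mul_sum]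
    congr 1
    · exact Finset.sum_congr rfl fun y _ => by ring
    · ring

/-! ### Coefficient bounds from the value at a point -/

/-- A power series with nonnegative coefficients whose partial sums at `z` are at most `s`. -/
def NonnegBoundedAt (z : ℝ) (φ : PowerSeries ℝ) (s : ℝ) : Prop :=
  (∀ k, 0 ≤ PowerSeries.coeff k φ) ∧
    ∀ N, ∑ k ∈ Finset.range N, PowerSeries.coeff k φ * z ^ k ≤ s

/-- The antidiagonals of index below `N` lie in the square `N × N`, over which the double sum
factors. Working with partial sums avoids all questions of convergence. -/
theorem NonnegBoundedAt.mul {z s t : ℝ} {φ ψ : PowerSeries ℝ} (hz : 0 ≤ z)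
    (hφ : NonnegBoundedAt z φ s) (hψ : NonnegBoundedAt z ψ t) :
    NonnegBoundedAt z (φ * ψ) (s * t) := by
  refine ⟨fun k => ?_, fun N => ?_⟩
  · rw [PowerSeries.coeff_mul]
    exact Finset.sum_nonneg fun a _ => mul_nonneg (hφ.1 _) (hψ.1 _)
  have hs : 0 ≤ s := by simpa using hφ.2 0
  calc ∑ k ∈ Finset.range N, PowerSeries.coeff k (φ * ψ) * z ^ k
      = ∑ k ∈ Finset.range N, ∑ a ∈ Finset.HasAntidiagonal.antidiagonal k,
          (PowerSeries.coeff a.1 φ * z ^ a.1) * (PowerSeries.coeff a.2 ψ * z ^ a.2) := by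
        refine Finset.sum_congr rfl fun k _ => ?_
        rw [PowerSeries.coeff_mul, Finset.sum_mul]
        refine Finset.sum_congr rfl fun a ha => ?_
        rw [← Finset.HasAntidiagonal.mem_antidiagonal.1 ha, pow_add]
        ring
    _ = ∑ a ∈ (Finset.range N).sigma fun k => Finset.HasAntidiagonal.antidiagonal k,
          (PowerSeries.coeff a.2.1 φ * z ^ a.2.1) * (PowerSeries.coeff a.2.2 ψ * z ^ a.2.2) := by
        rw [Finset.sum_sigma]
    _ ≤ ∑ b ∈ Finset.range N ×ˢ Finset.range N,
          (PowerSeries.coeff b.1 φ * z ^ b.1) * (PowerSeries.coeff b.2 ψ * z ^ b.2) := by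
        have hinj : Set.InjOn (fun a : (Σ _ : ℕ, ℕ × ℕ) => a.2)
            ((Finset.range N).sigma fun k => Finset.HasAntidiagonal.antidiagonal k) := by
          rintro ⟨k, a⟩ ha ⟨l, b⟩ hb h
          simp only [Finset.coe_sigma, Set.mem_sigma_iff, Finset.mem_coe,
            Finset.HasAntidiagonal.mem_antidiagonal] at ha hb h
          subst h
          obtain rfl : k = l := ha.2.symm.trans hb.2
          rfl
        rw [← Finset.sum_image (f := fun b : ℕ × ℕ =>
          (PowerSeries.coeff b.1 φ * z ^ b.1) * (PowerSeries.coeff b.2 ψ * z ^ b.2)) hinj]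
        refine Finset.sum_le_sum_of_subset_of_nonneg ?_ fun b _ _ =>
          mul_nonneg (mul_nonneg (hφ.1 _) (by positivity)) (mul_nonneg (hψ.1 _) (by positivity))
        intro b hb
        obtain ⟨⟨k, a⟩, ha, rfl⟩ := Finset.mem_image.1 hb
        simp only [Finset.mem_sigma, Finset.mem_range, Finset.HasAntidiagonal.mem_antidiagonal] at ha
        simp only [Finset.mem_product, Finset.mem_range]
        omega
    _ = (∑ k ∈ Finset.range N, PowerSeries.coeff k φ * z ^ k) *
          ∑ k ∈ Finset.range N, PowerSeries.coeff k ψ * z ^ k := by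
        rw [Finset.sum_mul_sum, Finset.sum_product]
    _ ≤ s * t := mul_le_mul (hφ.2 N) (hψ.2 N)
        (Finset.sum_nonneg fun k _ => mul_nonneg (hψ.1 _) (by positivity)) hs

theorem NonnegBoundedAt.prod {ι : Type*} {z : ℝ} (hz : 0 ≤ z) (F : Finset ι)
    {φ : ι → PowerSeries ℝ} {s : ι → ℝ} (h : ∀ x ∈ F, NonnegBoundedAt z (φ x) (s x)) :
    NonnegBoundedAt z (∏ x ∈ F, φ x) (∏ x ∈ F, s x) := by
  classical
  induction F using Finset.induction_on with
  | empty =>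
    refine ⟨fun k => ?_, fun N => ?_⟩
    · rw [Finset.prod_empty, PowerSeries.coeff_one]; split_ifs <;> norm_num
    · simp only [Finset.prod_empty, PowerSeries.coeff_one, ite_mul, one_mul, zero_mul,
        Finset.sum_ite_eq']
      split_ifs <;> simp
  | insert a F ha ih =>
    rw [Finset.prod_insert ha, Finset.prod_insert ha]
    exact (h a (by simp)).mul hz (ih fun x hx => h x (by simp [hx]))

theorem NonnegBoundedAt.coeff_mul_pow_le {z s : ℝ} {φ : PowerSeries ℝ} (hz : 0 ≤ z)
    (h : NonnegBoundedAt z φ s) (n : ℕ) : PowerSeries.coeff n φ * z ^ n ≤ s :=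
  (Finset.single_le_sum (f := fun k => PowerSeries.coeff k φ * z ^ k)
    (fun k _ => mul_nonneg (h.1 k) (by positivity)) (Finset.self_mem_range_succ n)).trans
    (h.2 (n + 1))

/-- Bound for the generating series of a function that is `1` from `2` on. -/
theorem nonnegBoundedAt_egs {z a : ℝ} (hz : 0 ≤ z) (ha : 0 ≤ a) {g : ℕ → ℝ} (h0 : 0 ≤ g 0)
    (h1 : 0 ≤ g 1) (h2 : ∀ k, 2 ≤ k → g k = 1) :
    NonnegBoundedAt z (egs a g)
      (Real.exp (z * a) + (g 0 - 1) + (g 1 - 1) * (z * a)) := by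
  have hg : ∀ k, 0 ≤ g k := by
    intro k
    match k with
    | 0 => exact h0
    | 1 => exact h1
    | k + 2 => rw [h2 _ (by omega)]; norm_num
  have hnn : ∀ k, 0 ≤ PowerSeries.coeff k (egs a g) := by
    intro k
    rw [egs, PowerSeries.coeff_mk]
    exact div_nonneg (mul_nonneg (hg k) (by positivity)) (by positivity)
  refine ⟨hnn, fun N => ?_⟩
  calc ∑ k ∈ Finset.range N, PowerSeries.coeff k (egs a g) * z ^ k
      -- Two extra terms, so that the exceptional indices `0` and `1` can be split off for every
      -- `N`.
      ≤ ∑ k ∈ Finset.range (N + 2), PowerSeries.coeff k (egs a g) * z ^ k :=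
        Finset.sum_le_sum_of_subset_of_nonneg (Finset.range_mono (by omega))
          fun k _ _ => mul_nonneg (hnn k) (by positivity)
    _ = ∑ k ∈ Finset.range (N + 2), (z * a) ^ k / (k.factorial : ℝ) + (g 0 - 1) +
          (g 1 - 1) * (z * a) := by
        have : ∀ k, PowerSeries.coeff k (egs a g) * z ^ k =
            g k * ((z * a) ^ k / (k.factorial : ℝ)) := by
          intro k
          rw [egs, PowerSeries.coeff_mk, mul_pow]
          ring
        simp_rw [this]
        rw [Finset.sum_range_succ', Finset.sum_range_succ', Finset.sum_range_succ',
          Finset.sum_range_succ']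
        rw [Finset.sum_congr rfl fun k _ => by rw [h2 (k + 1 + 1) (by omega), one_mul]]
        simp
        ring
    _ ≤ _ := by
        gcongr
        exact Real.sum_le_exp_of_nonneg (by positivity) _

/-! ### Elementary inequalities for the Poisson factors -/

/-- This is `x ≤ sinh x` at `x = m / 2`, multiplied by `2 * exp x`. -/
theorem mul_exp_half_le {m : ℝ} (hm : 0 ≤ m) : m * Real.exp (m / 2) ≤ Real.exp m - 1 := by
  have h : m / 2 ≤ Real.sinh (m / 2) := Real.self_le_sinh_iff.2 (by positivity)
  rw [Real.sinh_eq] at h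
  have h1 : Real.exp m = Real.exp (m / 2) * Real.exp (m / 2) := by rw [← Real.exp_add]; congr 1; ring
  have h2 : Real.exp (-(m / 2)) * Real.exp (m / 2) = 1 := by rw [← Real.exp_add]; simp
  nlinarith [Real.exp_pos (m / 2)]

/-- No smallness of `w` is assumed: in `poisson_factor_le` the product `u * m` is unbounded. -/
theorem exp_sub_one_sub_le (w : ℝ) : Real.exp w - 1 - w ≤ w ^ 2 * Real.exp |w| := by
  have h := Complex.norm_exp_sub_sum_le_norm_mul_exp (w : ℂ) 2
  have h1 : Complex.exp w - ∑ m ∈ Finset.range 2, (w : ℂ) ^ m / (m.factorial : ℂ) =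
      ((Real.exp w - 1 - w : ℝ) : ℂ) := by
    simp [Finset.sum_range_succ]
    ring
  rw [h1, Complex.norm_real, Complex.norm_real, Real.norm_eq_abs, Real.norm_eq_abs, sq_abs] at h
  exact (le_abs_self _).trans h

/-- For a Poisson count of mean `m`, the left side is `exp m` times the exponential moment of an
item's contribution. The terms linear in `u` cancel, since the values `0` and `1` contribute `-u *
m` and `u * m`. The rest is at most `u ^ 2 * m * (exp m - 1) + u ^ 2 * m`. -/
theorem poisson_factor_le {u m : ℝ} (hu : |u| ≤ 1 / 2) (hm : 0 ≤ m) :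
    Real.exp m + (Real.exp (-(u * m)) - 1) + (Real.exp u - 1) * m ≤
      Real.exp m * Real.exp (u ^ 2 * m) := by
  have h1 : Real.exp u - 1 ≤ u + u ^ 2 := by
    have := Real.abs_exp_sub_one_sub_id_le (x := u) (by linarith)
    linarith [(abs_le.1 this).2]
  have h2 := exp_sub_one_sub_le (-(u * m))
  have h3 : Real.exp |(-(u * m))| ≤ Real.exp (m / 2) := by
    apply Real.exp_le_exp.2
    rw [abs_neg, abs_mul, abs_of_nonneg hm]
    nlinarith
  have h4 := mul_exp_half_le hm
  have h5 : Real.exp (-(u * m)) - 1 + u * m ≤ u ^ 2 * m * (Real.exp m - 1) := by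
    calc Real.exp (-(u * m)) - 1 + u * m ≤ (-(u * m)) ^ 2 * Real.exp (m / 2) := by
          nlinarith [sq_nonneg (u * m)]
      _ = u ^ 2 * m * (m * Real.exp (m / 2)) := by ring
      _ ≤ _ := by gcongr
  have h6 : u ^ 2 * m + 1 ≤ Real.exp (u ^ 2 * m) := Real.add_one_le_exp _
  calc _ ≤ Real.exp m * (u ^ 2 * m + 1) := by nlinarith
    _ ≤ _ := by gcongr

theorem exp_one_mul_pow_le (n : ℕ) :
    Real.exp 1 * (n : ℝ) ^ (n + 1) ≤ ((n : ℝ) + 1) ^ (n + 1) := by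
  rcases Nat.eq_zero_or_pos n with rfl | hn
  · simp
  have hn' : (0 : ℝ) < n := by exact_mod_cast hn
  have h1 : Real.exp (1 / ((n : ℝ) + 1)) ≤ ((n : ℝ) + 1) / n := by
    rw [← Real.le_log_iff_exp_le (by positivity)]
    have := Real.one_sub_inv_le_log_of_pos (x := ((n : ℝ) + 1) / n) (by positivity)
    refine le_trans (le_of_eq ?_) this
    field_simp
    ring
  have h2 : Real.exp 1 ≤ (((n : ℝ) + 1) / n) ^ (n + 1) := by
    calc Real.exp 1 = Real.exp (1 / ((n : ℝ) + 1)) ^ (n + 1) := by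
          rw [← Real.exp_nat_mul]
          congr 1
          push_cast
          field_simp
      _ ≤ _ := by gcongr
  rw [div_pow, le_div_iff₀ (by positivity)] at h2
  exact h2

/-- The inverse of the probability that a Poisson variable equals its mean `n` is at most
`e * n`. -/
theorem factorial_mul_exp_le {n : ℕ} (hn : 1 ≤ n) :
    (n.factorial : ℝ) * Real.exp n ≤ Real.exp 1 * n * (n : ℝ) ^ n := by
  induction n, hn using Nat.le_induction with
  | base => simp
  | succ n hn ih =>
    have h := exp_one_mul_pow_le n
    rw [Nat.factorial_succ]
    push_cast
    rw [Real.exp_add]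
    calc ((n : ℝ) + 1) * n.factorial * (Real.exp n * Real.exp 1)
        = ((n : ℝ) + 1) * Real.exp 1 * (n.factorial * Real.exp n) := by ring
      _ ≤ ((n : ℝ) + 1) * Real.exp 1 * (Real.exp 1 * n * (n : ℝ) ^ n) := by gcongr
      _ = Real.exp 1 * (n + 1) * (Real.exp 1 * (n : ℝ) ^ (n + 1)) := by ring
      _ ≤ Real.exp 1 * (n + 1) * ((n : ℝ) + 1) ^ (n + 1) := by gcongr

/-! ### Concentration of the Good-Turing error -/

/-- The contribution of an item of mass `p` that occurs `k` times among `n` samples to the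
difference of the Good-Turing estimate and the missing mass. -/
noncomputable def turingTerm (n : ℕ) (p : ℝ) (k : ℕ) : ℝ :=
  (if k = 1 then 1 / (n : ℝ) else 0) - if k = 0 then p else 0

theorem sum_measureReal_singleton_le_one {𝒳 : Type*} [MeasurableSpace 𝒳]
    [DiscreteMeasurableSpace 𝒳] (Q : Measure 𝒳) [IsProbabilityMeasure Q] (F : Finset 𝒳) :
    ∑ y ∈ F, Q.real {y} ≤ 1 := by
  rw [sum_measureReal_singleton]
  exact measureReal_le_one

/-- The difference of the Good-Turing estimate and the missing mass of the items in `A` after `n`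
samples. -/
noncomputable def turingError {𝒳 : Type*} [MeasurableSpace 𝒳] (Q : Measure 𝒳) (A : Set 𝒳) (w : ℕ → 𝒳) (n : ℕ) : ℝ :=
  ({y ∈ A | count w n y = 1}.ncard : ℝ) / n - Q.real (A \ {y | ∃ m < n, w m = y})

/-- This disposes of deviations `ε > 1`, for which the Chernoff parameter `ε / 2` would leave the
range `|u| ≤ 1 / 2`. -/
theorem abs_turingError_le_one {𝒳 : Type*} [MeasurableSpace 𝒳] {Q : Measure 𝒳}
    [IsProbabilityMeasure Q] (A : Set 𝒳) (w : ℕ → 𝒳) {n : ℕ} (hn : 1 ≤ n) :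
    |turingError Q A w n| ≤ 1 := by
  classical
  have hn' : (0 : ℝ) < n := by exact_mod_cast hn
  have h1 : Q.real (A \ {y | ∃ m < n, w m = y}) ≤ 1 := measureReal_le_one
  have h2 : 0 ≤ Q.real (A \ {y | ∃ m < n, w m = y}) := measureReal_nonneg
  have h3 : ({y ∈ A | count w n y = 1}.ncard : ℝ) / n ≤ 1 := by
    rw [div_le_one hn']
    have : {y ∈ A | count w n y = 1}.ncard ≤ n := by
      calc _ ≤ (((Finset.range n).image w : Finset 𝒳) : Set 𝒳).ncard := by
            refine Set.ncard_le_ncard (fun y hy => ?_) (Finset.finite_toSet _)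
            have : count w n y ≠ 0 := by rw [hy.2]; norm_num
            rw [Ne, count_eq_zero_iff] at this
            push Not at this
            obtain ⟨m, hm, rfl⟩ := this
            simp only [Finset.coe_image, Finset.coe_range]
            exact ⟨m, hm, rfl⟩
        _ ≤ n := by
            rw [Set.ncard_coe_finset]
            exact Finset.card_image_le.trans (by simp)
    exact_mod_cast this
  have h4 : 0 ≤ ({y ∈ A | count w n y = 1}.ncard : ℝ) / n := by positivity
  rw [turingError, abs_le]
  constructor <;> linarith

section Concentration

variable {Ω 𝒳 : Type*} [MeasurableSpace Ω] {μ : Measure Ω} [IsProbabilityMeasure μ]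
  [Countable 𝒳] [MeasurableSpace 𝒳] [DiscreteMeasurableSpace 𝒳] {Y : ℕ → Ω → 𝒳}
  {Q : Measure 𝒳} [IsProbabilityMeasure Q]

/-- Evaluating the generating series at `z = n` gives an item of mass `p` the Poisson mean `n * p`.
These means and `n * q` add up to `n`, so the bound does not depend on `F`. -/
theorem integral_exp_sum_turingTerm_le
    (hY : ∀ n, Measurable (Y n)) (hlaw : ∀ n, μ.map (Y n) = Q) (hind : iIndepFun Y μ)
    (F : Finset 𝒳) {n : ℕ} (hn : 1 ≤ n) {u : ℝ} (hu : |u| ≤ 1 / 2) :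
    ∫ ω, ∏ x ∈ F, Real.exp (u * n * turingTerm n (Q.real {x}) (count (fun m => Y m ω) n x)) ∂μ ≤
      Real.exp 1 * n * Real.exp (u ^ 2 * n) := by
  have hn' : (0 : ℝ) < n := by exact_mod_cast hn
  have hF := sum_measureReal_singleton_le_one Q F
  rw [integral_prod_count_eq_coeff hY hlaw hind F
    (fun x k => Real.exp (u * n * turingTerm n (Q.real {x}) k)) n]
  set q : ℝ := 1 - ∑ y ∈ F, Q.real {y} with hq
  have hb0 : NonnegBoundedAt n (egs q fun _ => 1) (Real.exp (n * q)) := by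
    have := nonnegBoundedAt_egs (z := n) (a := q) (g := fun _ => 1) hn'.le (by linarith)
      (by norm_num) (by norm_num) (fun _ _ => rfl)
    simpa using this
  have hb1 : ∀ x ∈ F, NonnegBoundedAt n
      (egs (Q.real {x}) fun k => Real.exp (u * n * turingTerm n (Q.real {x}) k))
      (Real.exp (n * Q.real {x}) + (Real.exp (-(u * (n * Q.real {x}))) - 1) +
        (Real.exp u - 1) * (n * Q.real {x})) := by
    intro x _
    have := nonnegBoundedAt_egs (z := n) (a := Q.real {x})
      (g := fun k => Real.exp (u * n * turingTerm n (Q.real {x}) k)) hn'.le measureReal_nonneg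
      (Real.exp_pos _).le (Real.exp_pos _).le (fun k hk => by
        have h0 : k ≠ 0 := by omega
        have h1 : k ≠ 1 := by omega
        simp [turingTerm, h0, h1])
    have e0 : u * n * turingTerm n (Q.real {x}) 0 = -(u * (n * Q.real {x})) := by
      simp [turingTerm]; ring
    have e1 : u * n * turingTerm n (Q.real {x}) 1 = u := by
      simp [turingTerm]; field_simp
    simp only [e0, e1] at this
    exact this
  have hb := (hb0.mul hn'.le (NonnegBoundedAt.prod hn'.le F hb1)).coeff_mul_pow_le hn'.le n
  have hprod : ∏ x ∈ F, (Real.exp (n * Q.real {x}) + (Real.exp (-(u * (n * Q.real {x}))) - 1) +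
      (Real.exp u - 1) * (n * Q.real {x})) ≤
      ∏ x ∈ F, Real.exp ((1 + u ^ 2) * n * Q.real {x}) := by
    refine Finset.prod_le_prod (fun x hx => ?_) fun x _ => ?_
    · simpa using (hb1 x hx).2 0
    · refine (poisson_factor_le hu (by positivity)).trans (le_of_eq ?_)
      rw [← Real.exp_add]
      congr 1
      ring
  rw [← Real.exp_sum, ← Finset.mul_sum] at hprod
  have hs : Real.exp (n * q) * Real.exp ((1 + u ^ 2) * n * ∑ y ∈ F, Q.real {y}) ≤
      Real.exp n * Real.exp (u ^ 2 * n) := by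
    rw [← Real.exp_add, ← Real.exp_add]
    apply Real.exp_le_exp.2
    have : u ^ 2 * n * ∑ y ∈ F, Q.real {y} ≤ u ^ 2 * n * 1 := by gcongr
    rw [hq]
    linarith
  have hfin := hb.trans ((mul_le_mul_of_nonneg_left hprod (Real.exp_pos _).le).trans hs)
  have hpow : (0 : ℝ) < (n : ℝ) ^ n := by positivity
  rw [← multinomialSeries] at hfin
  refine le_of_mul_le_mul_right ?_ hpow
  calc _ = (n.factorial : ℝ) * (PowerSeries.coeff n (multinomialSeries q (fun y => Q.real {y}) F
          fun x k => Real.exp (u * n * turingTerm n (Q.real {x}) k)) * (n : ℝ) ^ n) := by ring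
    _ ≤ n.factorial * (Real.exp n * Real.exp (u ^ 2 * n)) := by gcongr
    _ = (n.factorial * Real.exp n) * Real.exp (u ^ 2 * n) := by ring
    _ ≤ (Real.exp 1 * n * (n : ℝ) ^ n) * Real.exp (u ^ 2 * n) := by
        gcongr ?_ * _
        exact factorial_mul_exp_le hn
    _ = _ := by ring

open scoped Classical in
theorem hasSum_turingError (A : Set 𝒳) (w : ℕ → 𝒳) (n : ℕ) :
    HasSum (A.indicator fun y => turingTerm n (Q.real {y}) (count w n y))
      (turingError Q A w n) := by
  have h1 : HasSum (fun y => if y ∈ {y ∈ A | count w n y = 1} then 1 / (n : ℝ) else 0)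
      (({y ∈ A | count w n y = 1}.ncard : ℝ) / n) := by
    have hfin : {y ∈ A | count w n y = 1}.Finite := by
      refine ((Finset.range n).image w).finite_toSet.subset fun y hy => ?_
      have : count w n y ≠ 0 := by rw [hy.2]; norm_num
      rw [Ne, count_eq_zero_iff] at this
      push Not at this
      obtain ⟨m, hm, rfl⟩ := this
      simp only [Finset.coe_image, Finset.coe_range]
      exact ⟨m, hm, rfl⟩
    have := hasSum_sum_of_ne_finset_zero (L := SummationFilter.unconditional 𝒳) (s := hfin.toFinset)
      (f := fun y => if y ∈ {y ∈ A | count w n y = 1} then 1 / (n : ℝ) else 0)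
      (fun y hy => by
        rw [Set.Finite.mem_toFinset] at hy
        rw [if_neg hy])
    convert this using 1
    rw [Finset.sum_congr rfl fun y hy => if_pos ((Set.Finite.mem_toFinset hfin).1 hy),
      Finset.sum_const, nsmul_eq_mul, Set.ncard_eq_toFinset_card _ hfin]
    ring
  have h2 : HasSum (fun y => if y ∈ A \ {y | ∃ m < n, w m = y} then Q.real {y} else 0)
      (Q.real (A \ {y | ∃ m < n, w m = y})) := by
    have h := Q.tsum_indicator_apply_singleton (A \ {y | ∃ m < n, w m = y})
      MeasurableSet.of_discrete
    have h' := ENNReal.hasSum_toReal (f := (A \ {y | ∃ m < n, w m = y}).indicator fun x => Q {x})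
      (by rw [h]; exact measure_ne_top _ _)
    rw [← ENNReal.tsum_toReal_eq, h] at h'
    · rw [measureReal_def]
      refine (congrArg (fun g : 𝒳 → ℝ => HasSum g _) (funext fun y => ?_)).mp h'
      simp only [Set.indicator_apply]
      split_ifs <;> simp [measureReal_def]
    · intro a
      rw [Set.indicator_apply]
      split_ifs <;> simp
  refine (congrArg (fun g : 𝒳 → ℝ => HasSum g _) (funext fun y => ?_)).mp (h1.sub h2)
  have hc := count_eq_zero_iff w n y
  by_cases hy : y ∈ A
  · have : (∃ m < n, w m = y) ↔ ¬ count w n y = 0 := by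
      rw [hc]; push Not; rfl
    simp [hy, turingTerm, this]
  · simp [hy]

theorem lintegral_exp_turingError_le
    (hY : ∀ n, Measurable (Y n)) (hlaw : ∀ n, μ.map (Y n) = Q) (hind : iIndepFun Y μ)
    (A : Set 𝒳) {n : ℕ} (hn : 1 ≤ n) {u : ℝ} (hu : |u| ≤ 1 / 2) :
    ∫⁻ ω, ENNReal.ofReal (Real.exp (u * n * turingError Q A (fun m => Y m ω) n)) ∂μ ≤
      ENNReal.ofReal (Real.exp 1 * n * Real.exp (u ^ 2 * n)) := by
  classical
  -- Countability exhausts the items by a sequence of finite sets; Fatou's lemma then passes the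
  -- bound, uniform over finite sets, to the limit.
  obtain ⟨G, hG⟩ := Filter.exists_seq_tendsto (Filter.atTop : Filter (Finset 𝒳))
  let Z : Finset 𝒳 → Ω → ℝ := fun F ω => ∏ x ∈ F with x ∈ A,
    Real.exp (u * n * turingTerm n (Q.real {x}) (count (fun m => Y m ω) n x))
  have hlim : ∀ ω, Filter.Tendsto (fun k => ENNReal.ofReal (Z (G k) ω)) Filter.atTop
      (nhds (ENNReal.ofReal (Real.exp (u * n * turingError Q A (fun m => Y m ω) n)))) := by
    intro ω
    refine (ENNReal.continuous_ofReal.tendsto _).comp ?_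
    have h := ((hasSum_turingError (Q := Q) A (fun m => Y m ω) n).comp hG).const_mul (u * n)
    refine ((Real.continuous_exp.tendsto _).comp h).congr fun k => ?_
    simp only [Z, Function.comp]
    rw [← Real.exp_sum, Finset.mul_sum, Finset.sum_filter]
    congr 1
    refine Finset.sum_congr rfl fun y _ => ?_
    rw [Set.indicator_apply]
    split_ifs <;> simp
  have hmeas : ∀ F, Measurable (Z F) := fun F => measurable_prod_count hY _
    (fun x k => Real.exp (u * n * turingTerm n (Q.real {x}) k)) n
  calc _ = ∫⁻ ω, Filter.liminf (fun k => ENNReal.ofReal (Z (G k) ω)) Filter.atTop ∂μ :=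
        lintegral_congr fun ω => (hlim ω).liminf_eq.symm
    _ ≤ Filter.liminf (fun k => ∫⁻ ω, ENNReal.ofReal (Z (G k) ω) ∂μ) Filter.atTop :=
        lintegral_liminf_le fun k => (hmeas _).ennreal_ofReal
    _ ≤ _ := by
        refine Filter.liminf_le_of_le (by isBoundedDefault) fun b hb => ?_
        obtain ⟨k, hk⟩ := hb.exists
        refine hk.trans ?_
        rw [← ofReal_integral_eq_lintegral_ofReal]
        · exact ENNReal.ofReal_le_ofReal (integral_exp_sum_turingTerm_le hY hlaw hind _ hn hu)
        · exact integrable_prod_count hY _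
            (fun x k => Real.exp (u * n * turingTerm n (Q.real {x}) k)) n
        · exact Filter.Eventually.of_forall fun ω =>
            Finset.prod_nonneg fun _ _ => (Real.exp_pos _).le

theorem measurable_turingError (hY : ∀ n, Measurable (Y n)) (A : Set 𝒳) (n : ℕ) :
    Measurable (fun ω => turingError Q A (fun m => Y m ω) n) := by
  classical
  obtain ⟨G, hG⟩ := Filter.exists_seq_tendsto (Filter.atTop : Filter (Finset 𝒳))
  refine measurable_of_tendsto_metrizable (f := fun k ω => ∑ y ∈ G k,
    A.indicator (fun y => turingTerm n (Q.real {y}) (count (fun m => Y m ω) n y)) y)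
    (fun k => ?_) (tendsto_pi_nhds.2 fun ω => (hasSum_turingError A (fun m => Y m ω) n).comp hG)
  refine Finset.measurable_sum _ fun y _ => ?_
  by_cases hy : y ∈ A
  · simp only [Set.indicator_of_mem hy]
    exact (measurable_of_countable (turingTerm n (Q.real {y}))).comp (measurable_count hY n y)
  · simp only [Set.indicator_of_notMem hy]
    exact measurable_const

theorem measure_lt_mul_turingError_le
    (hY : ∀ n, Measurable (Y n)) (hlaw : ∀ n, μ.map (Y n) = Q) (hind : iIndepFun Y μ)
    (A : Set 𝒳) {n : ℕ} (hn : 1 ≤ n) {ε σ : ℝ} (hε : 0 ≤ ε) (hε1 : ε ≤ 1) (hσ : σ ^ 2 = 1) :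
    μ {ω | ε < σ * turingError Q A (fun m => Y m ω) n} ≤
      ENNReal.ofReal (Real.exp 1 * n * Real.exp (-(n * ε ^ 2 / 4))) := by
  have hn' : (0 : ℝ) < n := by exact_mod_cast hn
  have hσ' : |σ| = 1 := by
    rcases (by simpa using hσ : σ = 1 ∨ σ = -1) with rfl | rfl <;> simp
  -- The Chernoff parameter `ε / 2` minimizes `u ^ 2 - u * ε`, with value `-ε ^ 2 / 4`; `σ` selects
  -- the tail.
  have hu : |σ * ε / 2| ≤ 1 / 2 := by
    rw [abs_div, abs_mul, hσ', abs_of_nonneg hε, abs_two]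
    linarith
  have h := lintegral_exp_turingError_le hY hlaw hind A hn hu
  have hm := mul_meas_ge_le_lintegral₀ (μ := μ) (f := fun ω => ENNReal.ofReal
    (Real.exp (σ * ε / 2 * n * turingError Q A (fun m => Y m ω) n)))
    (((measurable_turingError (Q := Q) hY A n).const_mul _).exp.ennreal_ofReal.aemeasurable)
    (ENNReal.ofReal (Real.exp (n * ε ^ 2 / 2)))
  have hsub : {ω | ε < σ * turingError Q A (fun m => Y m ω) n} ⊆
      {ω | ENNReal.ofReal (Real.exp (n * ε ^ 2 / 2)) ≤ ENNReal.ofReal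
        (Real.exp (σ * ε / 2 * n * turingError Q A (fun m => Y m ω) n))} := by
    intro ω hω
    refine ENNReal.ofReal_le_ofReal (Real.exp_le_exp.2 ?_)
    have : ε * (n * ε / 2) ≤ σ * turingError Q A (fun m => Y m ω) n * (n * ε / 2) :=
      mul_le_mul_of_nonneg_right (le_of_lt hω) (by positivity)
    linarith
  have h1 := (mul_le_mul_right (measure_mono (μ := μ) hsub)
    (ENNReal.ofReal (Real.exp (n * ε ^ 2 / 2)))).trans (hm.trans h)
  have he : ENNReal.ofReal (Real.exp (-(n * ε ^ 2 / 2))) *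
      ENNReal.ofReal (Real.exp (n * ε ^ 2 / 2)) = 1 := by
    rw [← ENNReal.ofReal_mul (Real.exp_pos _).le, ← Real.exp_add]
    simp
  calc μ {ω | ε < σ * turingError Q A (fun m => Y m ω) n}
      = ENNReal.ofReal (Real.exp (-(n * ε ^ 2 / 2))) * (ENNReal.ofReal (Real.exp (n * ε ^ 2 / 2)) *
          μ {ω | ε < σ * turingError Q A (fun m => Y m ω) n}) := by
        rw [← mul_assoc, he, one_mul]
    _ ≤ ENNReal.ofReal (Real.exp (-(n * ε ^ 2 / 2))) *
          ENNReal.ofReal (Real.exp 1 * n * Real.exp ((σ * ε / 2) ^ 2 * n)) := by gcongr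
    _ = _ := by
        rw [← ENNReal.ofReal_mul (Real.exp_pos _).le]
        congr 1
        have : Real.exp (-(n * ε ^ 2 / 4)) =
            Real.exp (-(n * ε ^ 2 / 2)) * Real.exp ((σ * ε / 2) ^ 2 * n) := by
          rw [← Real.exp_add]
          congr 1
          rw [div_pow, mul_pow, hσ]
          ring
        rw [this]
        ring

/-- Concentration of the Good-Turing estimate around the missing mass. -/
theorem measure_lt_abs_turingError_le
    (hY : ∀ n, Measurable (Y n)) (hlaw : ∀ n, μ.map (Y n) = Q) (hind : iIndepFun Y μ)
    (A : Set 𝒳) {n : ℕ} (hn : 1 ≤ n) {ε : ℝ} (hε : 0 ≤ ε) :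
    μ {ω | ε < |turingError Q A (fun m => Y m ω) n|} ≤
      ENNReal.ofReal (2 * (Real.exp 1 * n * Real.exp (-(n * ε ^ 2 / 4)))) := by
  rcases le_or_gt ε 1 with h1 | h1
  · have hsub : {ω | ε < |turingError Q A (fun m => Y m ω) n|} ⊆
        {ω | ε < 1 * turingError Q A (fun m => Y m ω) n} ∪
          {ω | ε < (-1) * turingError Q A (fun m => Y m ω) n} := by
      intro ω hω
      rcases lt_abs.1 (show ε < |turingError Q A (fun m => Y m ω) n| from hω) with h | h
      · left; simpa using h
      · right; simpa using h
    refine (measure_mono hsub).trans ((measure_union_le _ _).trans ?_)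
    rw [two_mul, ENNReal.ofReal_add (by positivity) (by positivity)]
    exact add_le_add (measure_lt_mul_turingError_le hY hlaw hind A hn hε h1 (by norm_num))
      (measure_lt_mul_turingError_le hY hlaw hind A hn hε h1 (by norm_num))
  · have : {ω | ε < |turingError Q A (fun m => Y m ω) n|} = ∅ := by
      ext ω
      simp only [Set.mem_ofPred_eq, Set.mem_empty_iff_false, iff_false, not_lt]
      exact (abs_turingError_le_one A _ hn).trans h1.le
    rw [this]
    simp

end Concentration

/-! ### Union bound over sample sizes and experts -/

/-- Comparison with the integral of `max x S ^ (-(c + 1))`, which is `S ^ (-c)` over `[0, S]` and at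
most `S ^ (-c) / c` beyond. -/
theorem sum_max_rpow_le {c S : ℝ} (hc : 0 < c) (hS : 1 ≤ S) (N : ℕ) :
    ∑ k ∈ Finset.range N, (max ((k : ℝ) + 1) S) ^ (-(c + 1)) ≤ (1 + 1 / c) * S ^ (-c) := by
  have hS0 : 0 < S := by linarith
  obtain ⟨M, hNM, hSM⟩ : ∃ M : ℕ, N ≤ M ∧ S ≤ M :=
    ⟨max N ⌈S⌉₊, le_max_left _ _, (Nat.le_ceil S).trans (by exact_mod_cast le_max_right _ _)⟩
  have hpos : ∀ x : ℝ, 0 < max x S := fun x => lt_max_of_lt_right hS0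
  set h : ℝ → ℝ := fun x => (max x S) ^ (-(c + 1)) with hh
  have hanti : Antitone h := fun x y hxy =>
    Real.rpow_le_rpow_of_nonpos (hpos x) (max_le_max_right S hxy) (by linarith)
  have hcont : Continuous h :=
    (continuous_id.max continuous_const).rpow_const fun x => Or.inl (hpos x).ne'
  have h1 : ∫ x in (0 : ℝ)..S, h x = S ^ (-c) := by
    rw [intervalIntegral.integral_congr (g := fun _ => S ^ (-(c + 1)))]
    · rw [intervalIntegral.integral_const, sub_zero, smul_eq_mul]
      nth_rewrite 1 [← Real.rpow_one S]
      rw [← Real.rpow_add hS0]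
      congr 1
      ring
    · intro x hx
      rw [Set.uIcc_of_le hS0.le] at hx
      simp only [hh]
      rw [max_eq_right hx.2]
  have h2 : ∫ x in S..(M : ℝ), h x ≤ S ^ (-c) / c := by
    rw [intervalIntegral.integral_congr (g := fun x => x ^ (-(c + 1)))]
    · rw [integral_rpow (Or.inr ⟨by linarith, ?_⟩)]
      · have e : -(c + 1) + 1 = -c := by ring
        rw [e, div_neg, ← neg_div, neg_sub]
        gcongr
        have : 0 ≤ (M : ℝ) ^ (-c) := by positivity
        linarith
      · rw [Set.uIcc_of_le hSM]
        exact fun hx => absurd hx.1 (by linarith)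
    · intro x hx
      rw [Set.uIcc_of_le hSM] at hx
      simp only [hh]
      rw [max_eq_left hx.1]
  calc ∑ k ∈ Finset.range N, (max ((k : ℝ) + 1) S) ^ (-(c + 1))
      ≤ ∑ k ∈ Finset.range M, (max ((k : ℝ) + 1) S) ^ (-(c + 1)) :=
        Finset.sum_le_sum_of_subset_of_nonneg (Finset.range_mono hNM) fun k _ _ => by
          have := hpos ((k : ℝ) + 1)
          positivity
    _ ≤ ∫ x in (0 : ℝ)..(0 + (M : ℝ)), h x := by
        have := (hanti.antitoneOn (Set.Icc 0 (0 + (M : ℝ)))).sum_le_integral (x₀ := 0) (a := M)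
        refine le_trans (le_of_eq ?_) this
        refine Finset.sum_congr rfl fun k _ => ?_
        simp [hh]
    _ = (∫ x in (0 : ℝ)..S, h x) + ∫ x in S..(M : ℝ), h x := by
        rw [zero_add, intervalIntegral.integral_add_adjacent_intervals] <;>
          exact hcont.intervalIntegrable _ _
    _ ≤ S ^ (-c) + S ^ (-c) / c := by rw [h1]; gcongr
    _ = _ := by ring

theorem four_le_one_add_sqrt_two_sq : 4 ≤ (1 + Real.sqrt 2) ^ 2 := by
  have : 1 ≤ Real.sqrt 2 := Real.one_le_sqrt.2 (by norm_num)
  nlinarith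

/-- The `4` inside the logarithm of the index absorbs the factor `2e` of the tail bound: `2e ≤ 16`,
and `4 ^ c ≥ c + 1` because `log 4 ≥ 1`. -/
theorem two_mul_exp_one_le {c : ℝ} (hc : 0 < c) :
    2 * Real.exp 1 * (4 : ℝ) ^ (-(c + 2)) ≤ 1 / (c + 1) := by
  have h1 : c + 1 ≤ (4 : ℝ) ^ c := by
    have h4 : 1 ≤ Real.log 4 := by
      rw [Real.le_log_iff_exp_le (by norm_num)]
      linarith [Real.exp_one_lt_d9]
    rw [Real.rpow_def_of_pos (by norm_num)]
    nlinarith [Real.add_one_le_exp (Real.log 4 * c)]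
  have h2 : (4 : ℝ) ^ (-(c + 2)) = ((4 : ℝ) ^ c)⁻¹ / 16 := by
    rw [Real.rpow_neg (by norm_num), Real.rpow_add (by norm_num)]
    norm_num
    ring
  have h3 : ((4 : ℝ) ^ c)⁻¹ ≤ 1 / (c + 1) := by
    rw [inv_eq_one_div]
    exact one_div_le_one_div_of_le (by linarith) h1
  have h4 : 0 < ((4 : ℝ) ^ c)⁻¹ := by positivity
  rw [h2]
  nlinarith [Real.exp_one_lt_d9]

/-- Since `(1 + √2) ^ 2 ≥ 4`, the exponential is at most `(4 * M) ^ (-(c + 2))` with `M = max (n +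
1) S`. One power of `M` pays for the prefactor `n`. -/
theorem deviation_bound_le {c S : ℝ} (hc : 0 < c) (hS : 1 ≤ S) (k : ℕ) :
    2 * (Real.exp 1 * ((k + 1 : ℕ) : ℝ) * Real.exp (-(((k + 1 : ℕ) : ℝ) *
      ((1 + Real.sqrt 2) * Real.sqrt (c + 2) * Real.sqrt
        (Real.log (4 * max (((k + 1 : ℕ) : ℝ) + 1) S) / ((k + 1 : ℕ) : ℝ))) ^ 2 / 4))) ≤
      1 / (c + 1) * (max ((k : ℝ) + 1) S) ^ (-(c + 1)) := by
  set n : ℝ := ((k + 1 : ℕ) : ℝ) with hn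
  have hn0 : 0 < n := by rw [hn]; positivity
  have hkn : (k : ℝ) + 1 = n := by rw [hn]; push_cast; ring
  rw [hkn]
  set M : ℝ := max (n + 1) S with hM
  have hM1 : 1 ≤ M := hS.trans (le_max_right _ _)
  have hnM : n ≤ M := le_trans (by linarith) (le_max_left (n + 1) S)
  have hlog : 0 ≤ Real.log (4 * M) := Real.log_nonneg (by linarith)
  have hexp : Real.exp (-(n * ((1 + Real.sqrt 2) * Real.sqrt (c + 2) *
      Real.sqrt (Real.log (4 * M) / n)) ^ 2 / 4)) ≤ (4 : ℝ) ^ (-(c + 2)) * M ^ (-(c + 2)) := by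
    rw [← Real.mul_rpow (by norm_num) (by linarith), Real.rpow_def_of_pos (by linarith)]
    apply Real.exp_le_exp.2
    rw [mul_pow, mul_pow, Real.sq_sqrt (by linarith), Real.sq_sqrt (by positivity)]
    have e : n * ((1 + Real.sqrt 2) ^ 2 * (c + 2) * (Real.log (4 * M) / n)) / 4 =
        (1 + Real.sqrt 2) ^ 2 / 4 * ((c + 2) * Real.log (4 * M)) := by
      field_simp
    rw [e]
    have : 1 * ((c + 2) * Real.log (4 * M)) ≤
        (1 + Real.sqrt 2) ^ 2 / 4 * ((c + 2) * Real.log (4 * M)) := by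
      gcongr
      linarith [four_le_one_add_sqrt_two_sq]
    linarith
  have hMpow : M * M ^ (-(c + 2)) = M ^ (-(c + 1)) := by
    nth_rewrite 1 [← Real.rpow_one M]
    rw [← Real.rpow_add (by linarith)]
    congr 1
    ring
  calc _ ≤ 2 * (Real.exp 1 * M * ((4 : ℝ) ^ (-(c + 2)) * M ^ (-(c + 2)))) := by gcongr
    _ = (2 * Real.exp 1 * (4 : ℝ) ^ (-(c + 2))) * (M * M ^ (-(c + 2))) := by ring
    _ ≤ 1 / (c + 1) * M ^ (-(c + 1)) := by
        rw [hMpow]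
        gcongr
        exact two_mul_exp_one_le hc
    _ ≤ 1 / (c + 1) * (max n S) ^ (-(c + 1)) := by
        have hpos : 0 < max n S := lt_max_of_lt_left hn0
        gcongr ?_ * ?_
        exact Real.rpow_le_rpow_of_nonpos hpos (max_le_max_right S (by linarith)) (by linarith)

/-- Disjointness is assumed for the supports only, so answers outside them must be excluded almost
surely. -/
theorem measure_notMem_supp {Ω 𝒳 : Type*} [MeasurableSpace Ω] {μ : Measure Ω} [Countable 𝒳]
    [MeasurableSpace 𝒳] [DiscreteMeasurableSpace 𝒳] {Z : Ω → 𝒳} {Q : Measure 𝒳} (hZ : Measurable Z) (hlaw : μ.map Z = Q) :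
    μ {ω | Z ω ∉ supp Q} = 0 := by
  have h : Q (supp Q)ᶜ = 0 := by
    rw [← Set.biUnion_of_singleton (supp Q)ᶜ, measure_biUnion_null_iff (Set.to_countable _)]
    intro y hy
    simpa [supp] using hy
  have h' : μ (Z ⁻¹' (supp Q)ᶜ) = 0 := by
    rw [← Measure.map_apply hZ MeasurableSet.of_discrete, hlaw, h]
  exact h'

section Event

variable {Ω 𝒳 : Type*} [MeasurableSpace Ω] {μ : Measure Ω} [IsProbabilityMeasure μ]
  [Countable 𝒳] [MeasurableSpace 𝒳] [DiscreteMeasurableSpace 𝒳]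

/-- Uniform concentration over all sample sizes for one expert. -/
theorem measure_exists_lt_abs_turingError_le {Y : ℕ → Ω → 𝒳}
    {Q : Measure 𝒳} [IsProbabilityMeasure Q]
    (hY : ∀ n, Measurable (Y n)) (hlaw : ∀ n, μ.map (Y n) = Q) (hind : iIndepFun Y μ)
    (A : Set 𝒳) {c S : ℝ} (hc : 0 < c) (hS : 1 ≤ S) :
    μ (⋃ k : ℕ, {ω | (1 + Real.sqrt 2) * Real.sqrt (c + 2) * Real.sqrt
        (Real.log (4 * max (((k + 1 : ℕ) : ℝ) + 1) S) / ((k + 1 : ℕ) : ℝ)) <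
        |turingError Q A (fun m => Y m ω) (k + 1)|}) ≤ ENNReal.ofReal (1 / (c * S ^ c)) := by
  refine (measure_iUnion_le _).trans ?_
  refine ENNReal.tsum_le_of_sum_range_le fun N => ?_
  calc _ ≤ ∑ k ∈ Finset.range N,
        ENNReal.ofReal (1 / (c + 1) * (max ((k : ℝ) + 1) S) ^ (-(c + 1))) :=
        Finset.sum_le_sum fun k _ => (measure_lt_abs_turingError_le hY hlaw hind A
          (Nat.le_add_left 1 k) (by positivity)).trans
            (ENNReal.ofReal_le_ofReal (deviation_bound_le hc hS k))
    _ = ENNReal.ofReal (1 / (c + 1) *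
          ∑ k ∈ Finset.range N, (max ((k : ℝ) + 1) S) ^ (-(c + 1))) := by
        rw [← ENNReal.ofReal_sum_of_nonneg, Finset.mul_sum]
        intro k _
        positivity
    _ ≤ ENNReal.ofReal (1 / (c + 1) * ((1 + 1 / c) * S ^ (-c))) := by
        gcongr
        exact sum_max_rpow_le hc hS N
    -- Here `(1 / (c + 1)) * (1 + 1 / c) = 1 / c`.
    _ = _ := by
        congr 1
        rw [Real.rpow_neg (by linarith)]
        have : (0 : ℝ) < S ^ c := by positivity
        field_simp

/-- The maximum with `S` widens the deviation for small samples, which makes the failure probability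
decay in `S`. It is harmless later, when the bound is applied only at times `s` with `S ≤ s + 1`. -/
theorem exists_concentration_event {K : ℕ} {P : Fin K → Measure 𝒳}
    [∀ i, IsProbabilityMeasure (P i)] (A : Set 𝒳) {X : Fin K → ℕ → Ω → 𝒳}
    (hX_meas : ∀ i n, Measurable (X i n)) (hX_law : ∀ i n, μ.map (X i n) = P i)
    (hX_indep : iIndepFun (fun p : Fin K × ℕ => X p.1 p.2) μ)
    {c S : ℝ} (hc : 0 < c) (hS : 1 ≤ S) :
    ∃ E : Set Ω, MeasurableSet E ∧ ENNReal.ofReal (1 - (K : ℝ) / (c * S ^ c)) ≤ μ E ∧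
      ∀ ω ∈ E, (∀ i m, X i m ω ∈ supp (P i)) ∧ ∀ i, ∀ n : ℕ, 1 ≤ n →
        |turingError (P i) A (fun m => X i m ω) n| ≤ (1 + Real.sqrt 2) * Real.sqrt (c + 2) *
          Real.sqrt (Real.log (4 * max ((n : ℝ) + 1) S) / n) := by
  let B : Fin K → Set Ω := fun i => ⋃ k : ℕ, {ω | (1 + Real.sqrt 2) * Real.sqrt (c + 2) *
    Real.sqrt (Real.log (4 * max (((k + 1 : ℕ) : ℝ) + 1) S) / ((k + 1 : ℕ) : ℝ)) <
      |turingError (P i) A (fun m => X i m ω) (k + 1)|}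
  let B0 : Set Ω := ⋃ i, ⋃ m, {ω | X i m ω ∉ supp (P i)}
  have hB0 : μ B0 = 0 := measure_iUnion_null fun i => measure_iUnion_null fun m =>
    measure_notMem_supp (hX_meas i m) (hX_law i m)
  have hB : ∀ i, μ (B i) ≤ ENNReal.ofReal (1 / (c * S ^ c)) := fun i =>
    measure_exists_lt_abs_turingError_le (hX_meas i) (hX_law i)
      (hX_indep.precomp (g := fun m : ℕ => (i, m)) fun a b h => (Prod.mk.inj h).2) A hc hS
  have hS0 : 0 < c * S ^ c := by positivity
  have hbad : μ (B0 ∪ ⋃ i, B i) ≤ ENNReal.ofReal (K / (c * S ^ c)) := by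
    calc μ (B0 ∪ ⋃ i, B i) ≤ μ B0 + ∑ i, μ (B i) :=
          (measure_union_le _ _).trans (by gcongr; exact measure_iUnion_fintype_le μ B)
      _ ≤ ∑ _i : Fin K, ENNReal.ofReal (1 / (c * S ^ c)) := by
          rw [hB0, zero_add]
          exact Finset.sum_le_sum fun i _ => hB i
      _ = _ := by
          rw [← ENNReal.ofReal_sum_of_nonneg fun _ _ => by positivity]
          congr 1
          simp
          ring
  -- A measurable hull of the bad set has the same measure, so measurability of the bad set is not
  -- needed.
  refine ⟨(toMeasurable μ (B0 ∪ ⋃ i, B i))ᶜ, (measurableSet_toMeasurable _ _).compl, ?_, ?_⟩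
  · rw [prob_compl_eq_one_sub (measurableSet_toMeasurable _ _), measure_toMeasurable,
      ENNReal.ofReal_sub _ (by positivity), ENNReal.ofReal_one]
    exact tsub_le_tsub_left hbad 1
  · intro ω hω
    have hω' : ω ∉ B0 ∪ ⋃ i, B i := fun h => hω (subset_toMeasurable _ _ h)
    rw [Set.mem_union, not_or] at hω'
    refine ⟨fun i m => ?_, fun i n hn => ?_⟩
    · by_contra h
      exact hω'.1 (Set.mem_iUnion.2 ⟨i, Set.mem_iUnion.2 ⟨m, h⟩⟩)
    · obtain ⟨k, rfl⟩ : ∃ k, n = k + 1 := ⟨n - 1, by omega⟩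
      by_contra h
      exact hω'.2 (Set.mem_iUnion.2 ⟨i, Set.mem_iUnion.2 ⟨k, not_le.1 h⟩⟩)

end Event

/-! ### Request counts and decoupling of the experts -/

section Pulls

variable {K : ℕ} (I : ℕ → Fin K)

theorem pulls_succ (t : ℕ) (i : Fin K) :
    pulls I (t + 1) i = pulls I t i + if I t = i then 1 else 0 := by
  unfold pulls
  rw [Finset.range_add_one, Finset.filter_insert]
  split_ifs <;> simp

theorem pulls_le (t : ℕ) (i : Fin K) : pulls I t i ≤ t :=
  (Finset.card_filter_le _ _).trans (by simp)

theorem sum_pulls (t : ℕ) : ∑ i, pulls I t i = t := by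
  induction t with
  | zero => simp [pulls]
  | succ t ih => simp [pulls_succ, Finset.sum_add_distrib, ih]

theorem pulls_eq_zero_or_exists_last (T : ℕ) (i : Fin K) :
    pulls I T i = 0 ∨ ∃ s < T, I s = i ∧ pulls I T i = pulls I s i + 1 := by
  induction T with
  | zero => left; simp [pulls]
  | succ T ih =>
    rw [pulls_succ]
    split_ifs with h
    · exact Or.inr ⟨T, Nat.lt_succ_self T, h, rfl⟩
    · rcases ih with ih | ⟨s, hs, h1, h2⟩
      · exact Or.inl ih
      · exact Or.inr ⟨s, hs.trans (Nat.lt_succ_self T), h1, h2⟩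

end Pulls

/-- The mass of the items of `A` that are not among the first `n` answers `w`. -/
noncomputable def missingMass {𝒳 : Type*} [MeasurableSpace 𝒳] (Q : Measure 𝒳) (A : Set 𝒳)
    (w : ℕ → 𝒳) (n : ℕ) : ℝ :=
  Q.real (A \ {y | ∃ m < n, w m = y})

theorem missingMass_antitone {𝒳 : Type*} [MeasurableSpace 𝒳] (Q : Measure 𝒳) [IsFiniteMeasure Q]
    (A : Set 𝒳) (w : ℕ → 𝒳) : Antitone (missingMass Q A w) := fun _ _ h =>
  measureReal_mono (Set.sdiff_subset_sdiff_right fun _ ⟨m, hm, e⟩ => ⟨m, hm.trans_le h, e⟩)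

section Experts

variable {𝒳 : Type*} [MeasurableSpace 𝒳] {K : ℕ} {P : Fin K → Measure 𝒳} {A : Set 𝒳}
  {x : Fin K → ℕ → 𝒳}

/-- An interesting item answered by expert `i` lies in no other support, so the other experts never
return it. -/
theorem goodTuring_eq
    (h_disj : ∀ i j, i ≠ j → A ∩ supp (P i) ∩ supp (P j) = ∅) (hx : ∀ i m, x i m ∈ supp (P i))
    (I : ℕ → Fin K) (t : ℕ) (i : Fin K) :
    goodTuring A x I t i =
      ({y ∈ A | count (x i) (pulls I t i) y = 1}.ncard : ℝ) / pulls I t i := by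
  unfold goodTuring
  congr 3
  ext y
  simp only [occ_eq_count, Set.mem_ofPred_eq]
  refine ⟨fun h => ⟨h.1, h.2.1⟩, fun h => ⟨h.1, h.2, ?_⟩⟩
  have hmem : ∀ j, count (x j) (pulls I t j) y ≠ 0 → y ∈ supp (P j) := by
    intro j hj
    rw [Ne, count_eq_zero_iff] at hj
    push Not at hj
    obtain ⟨m, _, rfl⟩ := hj
    exact hx j m
  rw [Finset.sum_eq_single i, h.2]
  · intro j _ hj
    by_contra hne
    have : y ∈ A ∩ supp (P j) ∩ supp (P i) :=
      ⟨⟨h.1, hmem j hne⟩, hmem i (by rw [h.2]; norm_num)⟩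
    rw [h_disj j i hj] at this
    exact this
  · simp

/-- Interesting items found only by other experts lie outside the support of `P i` and carry no mass
there. -/
theorem measureReal_diff_seen [Countable 𝒳] [∀ i, IsFiniteMeasure (P i)]
    (h_disj : ∀ i j, i ≠ j → A ∩ supp (P i) ∩ supp (P j) = ∅) (hx : ∀ i m, x i m ∈ supp (P i))
    (I : ℕ → Fin K) (t : ℕ) (i : Fin K) :
    (P i).real (A \ seen x I t) = missingMass (P i) A (x i) (pulls I t i) := by
  apply le_antisymm
  · exact measureReal_mono (Set.sdiff_subset_sdiff_right fun y ⟨m, hm, e⟩ => ⟨i, m, hm, e⟩)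
  have hnull : P i ((A ∩ seen x I t) \ {y | ∃ m < pulls I t i, x i m = y}) = 0 := by
    rw [← Set.biUnion_of_singleton ((A ∩ seen x I t) \ _),
      measure_biUnion_null_iff (Set.to_countable _)]
    rintro y ⟨⟨hyA, j, m, hm, rfl⟩, hy⟩
    by_contra hne
    have hij : i ≠ j := by
      rintro rfl
      exact hy ⟨m, hm, rfl⟩
    have : x j m ∈ A ∩ supp (P i) ∩ supp (P j) := ⟨⟨hyA, hne⟩, hx j m⟩
    rw [h_disj i j hij] at this
    exact this
  have hnull' : (P i).real ((A ∩ seen x I t) \ {y | ∃ m < pulls I t i, x i m = y}) = 0 := by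
    rw [measureReal_def, hnull, ENNReal.toReal_zero]
  calc missingMass (P i) A (x i) (pulls I t i)
      ≤ (P i).real (A \ seen x I t ∪ ((A ∩ seen x I t) \ {y | ∃ m < pulls I t i, x i m = y})) := by
        refine measureReal_mono fun y hy => ?_
        by_cases h : y ∈ seen x I t
        · exact Or.inr ⟨⟨hy.1, h⟩, hy.2⟩
        · exact Or.inl ⟨hy.1, h⟩
    _ ≤ (P i).real (A \ seen x I t) + 0 := by
        rw [← hnull']
        exact measureReal_union_le _ _
    _ = _ := add_zero _

end Experts

/-! ### Waiting times and the comparison with the oracle -/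

/-- Both infima, over request sequences and over times, are attained in `ℕ∞`; finiteness makes the
set of times nonempty. -/
theorem exists_requests_of_oracleTime_eq {𝒳 : Type*} [MeasurableSpace 𝒳] {K : ℕ}
    {P : Fin K → Measure 𝒳} {A : Set 𝒳} {x : Fin K → ℕ → 𝒳} {l : ℝ} {T : ℕ} [NeZero K]
    (h : oracleTime P A x l = (T : ℕ∞)) :
    ∃ J : ℕ → Fin K, ∀ i, (P i).real (A \ seen x J T) ≤ l := by
  obtain ⟨J, hJ⟩ := ENat.exists_eq_iInf (fun I : ℕ → Fin K => waitingTime P A x I l)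
  refine ⟨J, ?_⟩
  have hw : waitingTime P A x J l = (T : ℕ∞) := hJ.trans h
  unfold waitingTime at hw
  have hne : ((fun t : ℕ => (t : ℕ∞)) ''
      {t : ℕ | 1 ≤ t ∧ ∀ i, (P i).real (A \ seen x J t) ≤ l}).Nonempty := by
    by_contra hemp
    rw [Set.not_nonempty_iff_eq_empty] at hemp
    rw [hemp, sInf_empty] at hw
    exact ENat.natCast_ne_top T hw.symm
  obtain ⟨t, ht, hte⟩ := csInf_mem hne
  rw [hw] at hte
  have : t = T := ENat.natCast_inj.1 hte
  exact this ▸ ht.2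

theorem waitingTime_eq_of_isLeast {𝒳 : Type*} [MeasurableSpace 𝒳] {K : ℕ}
    {P : Fin K → Measure 𝒳} {A : Set 𝒳} {x : Fin K → ℕ → 𝒳} {I : ℕ → Fin K} {l : ℝ} {T : ℕ}
    (h : IsLeast {t : ℕ | 1 ≤ t ∧ ∀ i, (P i).real (A \ seen x I t) ≤ l} T) :
    waitingTime P A x I l = (T : ℕ∞) := by
  refine le_antisymm (sInf_le ⟨T, h.1, rfl⟩) (le_sInf ?_)
  rintro _ ⟨t, ht, rfl⟩
  exact Nat.cast_le.2 (h.2 ht)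

/-- If every request before time `T` was needed, then the last request to an expert was either
early or made while the missing mass of that expert was above the lowered threshold. -/
theorem early_or_lt_missingMass {𝒳 : Type*} [MeasurableSpace 𝒳] [Countable 𝒳] {K : ℕ}
    {P : Fin K → Measure 𝒳} [∀ i, IsProbabilityMeasure (P i)] {A : Set 𝒳} {x : Fin K → ℕ → 𝒳}
    (h_disj : ∀ i j, i ≠ j → A ∩ supp (P i) ∩ supp (P j) = ∅) (hx : ∀ i m, x i m ∈ supp (P i))
    {c S : ℝ} (hc : 0 < c) (hS : 8 ≤ S)
    (hq : 2 * (1 + Real.sqrt 2) * Real.sqrt ((c + 2) / S) ≤ 1)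
    (hconc : ∀ i, ∀ n : ℕ, 1 ≤ n → |turingError (P i) A (x i) n| ≤
      (1 + Real.sqrt 2) * Real.sqrt (c + 2) *
        Real.sqrt (Real.log (4 * max ((n : ℝ) + 1) S) / n))
    {I : ℕ → Fin K} (hI : IsGoodUCB ((1 + Real.sqrt 2) * Real.sqrt (c + 2)) A x I)
    {l : ℝ} {T : ℕ} (hT : ∀ t, 1 ≤ t → t < T → ¬ ∀ i, (P i).real (A \ seen x I t) ≤ l)
    {s : ℕ} (hs : s < T) :
    (pulls I s (I s) : ℝ) + 1 ≤ S * Real.log (4 * T) ∨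
      l - 3 / S - 2 * (1 + Real.sqrt 2) * Real.sqrt ((c + 2) / S) <
        missingMass (P (I s)) A (x (I s)) (pulls I s (I s)) := by
  set C : ℝ := (1 + Real.sqrt 2) * Real.sqrt (c + 2) with hC
  have hC0 : 0 ≤ C := by positivity
  set i := I s with hi
  set n := pulls I s i with hn
  set q : ℝ := 2 * (1 + Real.sqrt 2) * Real.sqrt ((c + 2) / S) with hqdef
  set L : ℝ := Real.log (4 * T) with hL
  have hsT : (s : ℝ) + 1 ≤ T := by exact_mod_cast hs
  have hL1 : 1 ≤ L := by
    rw [hL, Real.le_log_iff_exp_le (by linarith [Nat.cast_nonneg (α := ℝ) s])]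
    linarith [Real.exp_one_lt_d9, Nat.cast_nonneg (α := ℝ) s]
  have hSL : S ≤ S * L := by nlinarith
  by_contra! hcon
  obtain ⟨h1, h2⟩ := hcon
  have hn1 : 1 ≤ n := by
    by_contra h
    have : n = 0 := by omega
    rw [this] at h1
    norm_num at h1
    linarith
  have hns : (n : ℝ) ≤ s := by exact_mod_cast pulls_le I s i
  -- In the initial round every request is the first one to its expert, contrary to `1 ≤ n`.
  have hKs : K ≤ s := by
    by_contra h
    have : pulls I s i = 0 := by
      rw [pulls, Finset.card_eq_zero, Finset.filter_eq_empty_iff]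
      intro r hr he
      have hr' := Finset.mem_range.1 hr
      have e1 := hI.1 r (by omega)
      have e2 := hI.1 s (by omega)
      rw [he, hi] at e1
      omega
    omega
  have hs1 : 1 ≤ s := hn1.trans (pulls_le I s i)
  have hj := hT s hs1 hs
  push Not at hj
  obtain ⟨j, hj⟩ := hj
  rw [measureReal_diff_seen h_disj hx] at hj
  have hnj : 1 ≤ pulls I s j := by
    rw [Nat.one_le_iff_ne_zero, pulls, Finset.card_ne_zero]
    exact ⟨j, Finset.mem_filter.2 ⟨Finset.mem_range.2 (j.2.trans_le hKs),
      Fin.ext (hI.1 j j.2)⟩⟩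
  have hdev : ∀ k : Fin K, 1 ≤ pulls I s k → |turingError (P k) A (x k) (pulls I s k)| ≤
      C * Real.sqrt (Real.log (4 * ((s : ℝ) + 1)) / pulls I s k) := by
    intro k hk
    refine (hconc k _ hk).trans ?_
    have hks : (pulls I s k : ℝ) ≤ s := by exact_mod_cast pulls_le I s k
    gcongr
    -- Here `S ≤ S * L < n + 1 ≤ s + 1`.
    exact max_le (by linarith) (by linarith)
  have herr : ∀ k : Fin K, turingError (P k) A (x k) (pulls I s k) =
      goodTuring A x I s k - missingMass (P k) A (x k) (pulls I s k) := by
    intro k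
    rw [goodTuring_eq h_disj hx]
    rfl
  have hdj := (abs_le.1 (hdev j hnj)).1
  have hdi := (abs_le.1 (hdev i hn1)).2
  have hucb := hI.2 s hKs j
  rw [herr] at hdj hdi
  rw [← hi] at hucb
  unfold ucbIndex at hucb
  rw [← hn] at hdi hucb
  have hn0 : (0 : ℝ) < n := by exact_mod_cast hn1
  have hroot : Real.sqrt (Real.log (4 * ((s : ℝ) + 1)) / n) ≤ Real.sqrt (L / n) := by
    apply Real.sqrt_le_sqrt
    rw [hL]
    gcongr
  -- The optimism chain: `l` is below the missing mass of `j`, hence below the index of `j`, hence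
  -- below that of `i`, which exceeds the missing mass of `i` by at most two bonuses.
  have hkey : l < missingMass (P i) A (x i) n + 2 * (C * Real.sqrt (L / n)) := by
    have := mul_le_mul_of_nonneg_left hroot hC0
    linarith
  have hS0 : 0 < S := by linarith
  -- Normalized so that `n = S * L` would give exactly `q`.
  have hsplit : 2 * (C * Real.sqrt (L / n)) = q * Real.sqrt (S * L / n) := by
    have e1 : S * L / n = S * (L / n) := by ring
    have e2 : Real.sqrt ((c + 2) / S) * Real.sqrt S = Real.sqrt (c + 2) := by
      rw [← Real.sqrt_mul (by positivity), div_mul_cancel₀ _ hS0.ne']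
    rw [e1, Real.sqrt_mul hS0.le, hC, ← e2, hqdef]
    ring
  have hD : 0 < S * L - 1 := by linarith
  -- Only `n > S * L - 1` is known; this off-by-one costs the `3 / S` in the threshold, using `q ≤
  -- 1`.
  have hratio : Real.sqrt (S * L / n) ≤ 1 + 1 / (S * L - 1) := by
    have h3 : S * L / n ≤ 1 + 1 / (S * L - 1) := by
      calc S * L / n ≤ S * L / (S * L - 1) := by
            gcongr
            linarith
        _ = _ := by field_simp; ring
    have h4 : (0 : ℝ) ≤ 1 / (S * L - 1) := by positivity
    calc Real.sqrt (S * L / n) ≤ Real.sqrt (1 + 1 / (S * L - 1)) := Real.sqrt_le_sqrt h3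
      _ ≤ 1 + 1 / (S * L - 1) := by
          rw [Real.sqrt_le_left (by linarith)]
          nlinarith
  have h5 : 1 / (S * L - 1) ≤ 3 / S := by
    rw [div_le_div_iff₀ hD hS0]
    linarith
  have hq0 : 0 ≤ q := by positivity
  have h6 : q * Real.sqrt (S * L / n) ≤ q + 3 / S := by
    have h4 : (0 : ℝ) ≤ 1 / (S * L - 1) := by positivity
    nlinarith [mul_le_mul_of_nonneg_left hratio hq0]
  linarith

/-- Write `log (4 * T) = 2 * log a + log (4 * T / a ^ 2)` and use `log y ≤ y`: the last term, times
`a`, is at most `4 * T / a ≤ T / 2` and is absorbed on the left. -/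
theorem le_of_le_add_mul_log {a T R : ℝ} (ha : 8 ≤ a) (hT : 1 ≤ T)
    (h : T ≤ R + a * Real.log (4 * T)) : T ≤ 2 * R + 4 * a * Real.log a := by
  have ha0 : 0 < a := by linarith
  have h1 : Real.log (4 * T) = 2 * Real.log a + Real.log (4 * T / a ^ 2) := by
    rw [Real.log_div (by linarith) (by positivity), Real.log_pow]
    push_cast
    ring
  have h2 : Real.log (4 * T / a ^ 2) ≤ 4 * T / a ^ 2 :=
    (Real.log_le_sub_one_of_pos (by positivity)).trans (by linarith)
  have h3 : a * Real.log (4 * T / a ^ 2) ≤ T / 2 := by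
    calc a * Real.log (4 * T / a ^ 2) ≤ a * (4 * T / a ^ 2) := by gcongr
      _ = 4 * T / a := by field_simp
      _ ≤ T / 2 := by
          rw [div_le_div_iff₀ ha0 (by norm_num)]
          nlinarith
  rw [h1] at h
  linarith

/-- The deterministic part of the analysis of Good-UCB. -/
theorem exists_waitingTime_le {𝒳 : Type*} [MeasurableSpace 𝒳] [Countable 𝒳] {K : ℕ}
    {P : Fin K → Measure 𝒳} [∀ i, IsProbabilityMeasure (P i)] {A : Set 𝒳} {x : Fin K → ℕ → 𝒳}
    (h_disj : ∀ i j, i ≠ j → A ∩ supp (P i) ∩ supp (P j) = ∅) (hx : ∀ i m, x i m ∈ supp (P i))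
    {c S : ℝ} (hc : 0 < c) (hS : 1 ≤ S)
    (hconc : ∀ i, ∀ n : ℕ, 1 ≤ n → |turingError (P i) A (x i) n| ≤
      (1 + Real.sqrt 2) * Real.sqrt (c + 2) *
        Real.sqrt (Real.log (4 * max ((n : ℝ) + 1) S) / n))
    {I : ℕ → Fin K} (hI : IsGoodUCB ((1 + Real.sqrt 2) * Real.sqrt (c + 2)) A x I)
    {l : ℝ} (hl : l < 1) {R : ℕ}
    (hR : oracleTime P A x (l - 3 / S - 2 * (1 + Real.sqrt 2) * Real.sqrt ((c + 2) / S)) =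
      (R : ℕ∞)) :
    ∃ T : ℕ, waitingTime P A x I l = (T : ℕ∞) ∧
      (T : ℝ) ≤ R + K * S * Real.log (8 * R + 16 * (K * S) * Real.log (K * S)) := by
  have hS0 : 0 < S := by linarith
  have hK : 1 ≤ K := (Nat.zero_le _).trans_lt (I 0).2
  have : NeZero K := ⟨by omega⟩
  obtain ⟨J, hJ⟩ := exists_requests_of_oracleTime_eq hR
  simp_rw [measureReal_diff_seen h_disj hx] at hJ
  -- A finite oracle time forces a nonnegative threshold. With `l < 1` this bounds the bonus by `1`
  -- and makes `S` at least `16 * (c + 2)`.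
  have hl' : 0 ≤ l - 3 / S - 2 * (1 + Real.sqrt 2) * Real.sqrt ((c + 2) / S) :=
    measureReal_nonneg.trans (hJ (I 0))
  have h3S : 0 ≤ 3 / S := by positivity
  have hq : 2 * (1 + Real.sqrt 2) * Real.sqrt ((c + 2) / S) ≤ 1 := by linarith
  have hS8 : 8 ≤ S := by
    have h1 : (2 * (1 + Real.sqrt 2) * Real.sqrt ((c + 2) / S)) ^ 2 ≤ 1 :=
      pow_le_one₀ (by positivity) hq
    rw [mul_pow, mul_pow, Real.sq_sqrt (by positivity)] at h1
    have h2 : 2 ^ 2 * 4 * ((c + 2) / S) ≤ 1 := by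
      refine le_trans ?_ h1
      gcongr
      exact four_le_one_add_sqrt_two_sq
    rw [← mul_div_assoc, div_le_one hS0] at h2
    linarith
  have hK' : (1 : ℝ) ≤ K := by exact_mod_cast hK
  -- Success at `T` is not assumed, so the inequality serves both to prove termination and to bound
  -- the waiting time.
  have hbound : ∀ T : ℕ, 1 ≤ T →
      (∀ t, 1 ≤ t → t < T → ¬ ∀ i, (P i).real (A \ seen x I t) ≤ l) →
      (T : ℝ) ≤ R + K * S * Real.log (4 * T) := by
    intro T hT1 hT
    have hT1' : (1 : ℝ) ≤ T := by exact_mod_cast hT1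
    have hlog : 0 ≤ S * Real.log (4 * T) :=
      mul_nonneg hS0.le (Real.log_nonneg (by linarith))
    have hi : ∀ i, (pulls I T i : ℝ) ≤ pulls J R i + S * Real.log (4 * T) := by
      intro i
      rcases pulls_eq_zero_or_exists_last I T i with h | ⟨s, hs, rfl, h⟩
      · rw [h, Nat.cast_zero]
        positivity
      · rw [h]
        -- In the second case the oracle leaves less mass missing at this expert, so by monotonicity
        -- it asked it strictly more often.
        rcases early_or_lt_missingMass h_disj hx hc hS8 hq hconc hI hT hs with h1 | h1
        · push_cast
          linarith [Nat.cast_nonneg (α := ℝ) (pulls J R (I s))]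
        · have h2 : pulls I s (I s) < pulls J R (I s) := by
            by_contra! hle
            exact absurd ((missingMass_antitone (P (I s)) A (x (I s)) hle).trans (hJ (I s)))
              (not_le.2 h1)
          have h3 : ((pulls I s (I s) + 1 : ℕ) : ℝ) ≤ pulls J R (I s) := by exact_mod_cast h2
          linarith
    calc (T : ℝ) = ∑ i, (pulls I T i : ℝ) := by
          rw [← Nat.cast_sum, sum_pulls]
      _ ≤ ∑ i, ((pulls J R i : ℝ) + S * Real.log (4 * T)) := Finset.sum_le_sum fun i _ => hi i
      _ = _ := by
          rw [Finset.sum_add_distrib, ← Nat.cast_sum, sum_pulls]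
          simp
          ring
  have ha : 8 ≤ (K : ℝ) * S := by nlinarith
  have hex : ∃ T : ℕ, 1 ≤ T ∧ ∀ i, (P i).real (A \ seen x I T) ≤ l := by
    by_contra! hno
    obtain ⟨T, hT⟩ := exists_nat_gt
      (max 1 (2 * (R : ℝ) + 4 * (K * S) * Real.log (K * S)))
    have hT1 : (1 : ℝ) ≤ T := (le_max_left _ _).trans hT.le
    have h := le_of_le_add_mul_log ha hT1 (hbound T (by exact_mod_cast hT1) fun t ht _ => by
      push Not
      exact hno t ht)
    exact absurd ((le_max_right _ _).trans_lt hT) (not_lt.2 h)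
  classical
  have hleast : IsLeast {t : ℕ | 1 ≤ t ∧ ∀ i, (P i).real (A \ seen x I t) ≤ l} (Nat.find hex) :=
    ⟨Nat.find_spec hex, fun t ht => Nat.find_min' hex ht⟩
  set T := Nat.find hex with hTdef
  have hT1 : 1 ≤ T := hleast.1.1
  have hT1' : (1 : ℝ) ≤ T := by exact_mod_cast hT1
  have hb := hbound T hT1 fun t ht htT hgood => absurd (hleast.2 ⟨ht, hgood⟩) (not_le.2 htT)
  -- The crude bound on `T` is fed back into the logarithm only, which keeps the coefficient of `R`
  -- outside it equal to `1`.
  have hb2 := le_of_le_add_mul_log ha hT1' hb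
  refine ⟨T, waitingTime_eq_of_isLeast hleast, hb.trans ?_⟩
  gcongr
  linarith

end Discovery

theorem theorem2 {Ω 𝒳 : Type*} [MeasurableSpace Ω] (μ : Measure Ω) [IsProbabilityMeasure μ]
    [Countable 𝒳] [MeasurableSpace 𝒳] [DiscreteMeasurableSpace 𝒳]
    (K : ℕ) (P : Fin K → Measure 𝒳) [∀ i, IsProbabilityMeasure (P i)] (A : Set 𝒳)
    (X : Fin K → ℕ → Ω → 𝒳)
    (hX_meas : ∀ i n, Measurable (X i n))
    (hX_law : ∀ i n, μ.map (X i n) = P i)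
    (hX_indep : iIndepFun (fun p : Fin K × ℕ => X p.1 p.2) μ)
    (h_disj : ∀ i j, i ≠ j → A ∩ Discovery.supp (P i) ∩ Discovery.supp (P j) = ∅)
    (c S : ℝ) (hc : 0 < c) (hS : 1 ≤ S)
    (I : Ω → ℕ → Fin K)
    (hI : ∀ ω, Discovery.IsGoodUCB ((1 + Real.sqrt 2) * Real.sqrt (c + 2)) A
      (fun i n => X i n ω) (I ω)) :
    ∃ E : Set Ω, MeasurableSet E ∧ ENNReal.ofReal (1 - (K : ℝ) / (c * S ^ c)) ≤ μ E ∧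
      ∀ ω ∈ E, ∀ l : ℝ, 0 < l → l < 1 → ∀ Tstar : ℕ,
        Discovery.oracleTime P A (fun i n => X i n ω)
            (l - 3 / S - 2 * (1 + Real.sqrt 2) * Real.sqrt ((c + 2) / S)) = (Tstar : ℕ∞) →
        ∃ T : ℕ, Discovery.waitingTime P A (fun i n => X i n ω) (I ω) l = (T : ℕ∞) ∧
          (T : ℝ) ≤ Tstar + K * S *
            Real.log (8 * Tstar + 16 * (K * S) * Real.log (K * S)) := by
  obtain ⟨E, hE, hμ, h⟩ := Discovery.exists_concentration_event A hX_meas hX_law hX_indep hc hS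
  exact ⟨E, hE, hμ, fun ω hω l _ hl Tstar hT =>
    Discovery.exists_waitingTime_le h_disj (h ω hω).1 hc hS (h ω hω).2 (hI ω) hl hT⟩
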